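/- Let $n\ge 1$ be an integer and let $r_1,r_2>0$. For $r>0$ let $S_r^{2n-1}=\{z\in\mathbb C^n:|z|=r\}$. Let $\mu$ be a finite complex Borel measure on $\mathbb C^n$ that is supported on $S_{r_1}^{2n-1}$ and absolutely continuous with respect to the surface measure of $S_{r_1}^{2n-1}$. For an integer $k\ge 0$ let $$L_k^{n-1}(x)=\sum_{j=0}^k\binom{n-1+k}{k-j}\frac{(-x)^j}{j!},\qquad \varphi_k^{n-1}(z)=L_k^{n-1}\!\left(\tfrac{|z|^2}{2}\right)e^{-|z|^2/4}\quad(z\in\mathbb C^n),$$ and define the $k$-th spectral projection of $\mu$ by $$(\varphi_k^{n-1}\times\mu)(z)=\int_{S_{r_1}^{2n-1}}\varphi_k^{n-1}(z-\omega)\,e^{\frac i2\operatorname{Im}(z\cdot\bar\omega)}\,d\mu(\omega),\qquad z\in\mathbb C^n,$$ where $z\cdot\bar\omega=\sum_{j=1}^n z_j\overline{\omega_j}$. If $(\varphi_k^{n-1}\times\mu)(z)=0$ for all $z\in S_{r_2}^{2n-1}$ and all integers $k\ge 0$, then $\mu=0$. -/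

import Mathlib

open MeasureTheory
open scoped ComplexConjugate

noncomputable section

/-- The Laguerre polynomial `L_k^m(x) = ∑_{j ≤ k} binom(m + k, k - j) (-x)^j / j!` of degree `k`
and order `m ∈ ℕ`. -/
def laguerrePoly (m k : ℕ) (x : ℝ) : ℝ :=
  ∑ j ∈ Finset.range (k + 1), ((m + k).choose (k - j) : ℝ) * (-x) ^ j / (j.factorial : ℝ)

/-- The Laguerre function `φ_k^{n-1}(z) = L_k^{n-1}(|z|² / 2) e^{-|z|² / 4}` on `ℂⁿ`, `n ≥ 1`. -/
def laguerreFun (n k : ℕ) (z : EuclideanSpace ℂ (Fin n)) : ℝ :=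
  laguerrePoly (n - 1) k (‖z‖ ^ 2 / 2) * Real.exp (-(‖z‖ ^ 2 / 4))

/-- The surface measure on the sphere of radius `r > 0` centred at the origin of `ℂⁿ = ℝ²ⁿ`, as a
Borel measure on `ℂⁿ`: the image under `ω ↦ r ω` of `r ^ (2n - 1)` times the surface measure of the
unit sphere. -/
def sphereSurfaceMeasure (n : ℕ) (r : ℝ) : Measure (EuclideanSpace ℂ (Fin n)) :=
  ENNReal.ofReal (r ^ (2 * n - 1)) •
    ((volume : Measure (EuclideanSpace ℂ (Fin n))).toSphere).map
      (fun ω : Metric.sphere (0 : EuclideanSpace ℂ (Fin n)) 1 =>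
        r • (ω : EuclideanSpace ℂ (Fin n)))

/-- The class `X(S_r^{2n-1})` of finite complex Borel measures on `ℂⁿ` which are supported on the
sphere of radius `r` and absolutely continuous with respect to its surface measure. -/
structure IsACSphereMeasure (n : ℕ) (r : ℝ) (μ : ComplexMeasure (EuclideanSpace ℂ (Fin n))) :
    Prop where
  supported : ∀ s : Set (EuclideanSpace ℂ (Fin n)), MeasurableSet s →
    Disjoint s (Metric.sphere 0 r) → μ s = 0
  absolutelyContinuous :
    VectorMeasure.AbsolutelyContinuous μ (sphereSurfaceMeasure n r).toENNRealVectorMeasure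

/-- The spectral projection
`(φ_k^{n-1} × μ)(z) = ∫ φ_k^{n-1}(z - ω) e^{(i/2) Im(z · ω̄)} dμ(ω)` of a complex measure `μ`
on `ℂⁿ`, where `z · ω̄ = ∑ j, z_j ω̄_j`. The last argument of `integral` is the pairing,
multiplication of complex numbers. -/
def spectralProjection (n k : ℕ) (μ : ComplexMeasure (EuclideanSpace ℂ (Fin n)))
    (z : EuclideanSpace ℂ (Fin n)) : ℂ :=
  VectorMeasure.integral μ
    (fun ω => (laguerreFun n k (z - ω) : ℂ) *
      Complex.exp (Complex.I / 2 * ((∑ j, z j * conj (ω j)).im : ℂ)))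
    (ContinuousLinearMap.mul ℝ ℂ)

end

/-! For $|\omega|=r_1$, $|z|=r_2$ put $w=z\cdot\bar\omega$ and $R=r_1^2+r_2^2$. The Gaussian and the
twist combine to $e^{-R/4}e^{w/2}$, holomorphic in $w$, and the Laguerre argument is $(R-w-\bar
w)/2$. As $k$ varies the Laguerre polynomials span all polynomials, so $\mu$ kills $(w+\bar w)^m
e^{w/2}$ for every $m$. Rotating $z$ to $\zeta z$, $|\zeta|=1$, gives $(\zeta w+\zeta^{-1}\bar w)^m
e^{\zeta w/2}$. By induction on the power of $\bar w$ only the term $\bar w^m e^{\zeta w/2}$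
survives; its integral is entire in $\zeta$ and zero on the circle, so all $w^i\bar w^j$ are killed
(`apply_pow_mul_pow_eq_zero`). Summing exponential series, the Fourier transform of $\mu$ vanishes
(`ComplexMeasure.eq_zero_of_fourier_eq_zero`). -/

/-! ### Moments of a functional on a commutative Banach algebra. -/

section BanachAlgebra

variable {A : Type*} [NormedCommRing A] [NormedAlgebra ℂ A]

/-- Vanishing of all Laguerre moments implies vanishing of all moments. -/
theorem apply_pow_mul_eq_zero_of_laguerre (Λ : A →L[ℂ] ℂ) (x b : A) (m : ℕ)
    (h : ∀ k, Λ ((∑ j ∈ Finset.range (k + 1),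
      (((m + k).choose (k - j) : ℂ) * (-1) ^ j / (j.factorial : ℂ)) • x ^ j) * b) = 0) (k : ℕ) :
    Λ (x ^ k * b) = 0 := by
  induction k using Nat.strong_induction_on with
  | _ k ih =>
    have h1 := h k
    -- Only the top term $j=k$ survives; its coefficient $(-1)^k/k!$ is nonzero.
    rw [Finset.sum_mul, map_sum, Finset.sum_range_succ, Finset.sum_eq_zero, zero_add,
      smul_mul_assoc, map_smul, smul_eq_zero] at h1
    · refine h1.resolve_left ?_
      simp [Nat.factorial_ne_zero]
    · intro j hj
      rw [smul_mul_assoc, map_smul, ih j (Finset.mem_range.1 hj), smul_zero]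

/-- Inverting the affine substitution, $u=R-2x$, makes $u^m$ a combination of powers of $x$. -/
theorem apply_pow_mul_eq_zero_of_affine (Λ : A →L[ℂ] ℂ) (u b : A) (R : ℂ)
    (h : ∀ k, Λ (((2⁻¹ : ℂ) • (algebraMap ℂ A R - u)) ^ k * b) = 0) (m : ℕ) :
    Λ (u ^ m * b) = 0 := by
  set x := (2⁻¹ : ℂ) • (algebraMap ℂ A R - u) with hx
  have hu : u = algebraMap ℂ A R + (-2 : ℂ) • x := by
    rw [hx, smul_smul, show (-2 : ℂ) * 2⁻¹ = -1 by norm_num, neg_one_smul]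
    abel
  rw [hu, add_pow, Finset.sum_mul, map_sum]
  refine Finset.sum_eq_zero fun j _ ↦ ?_
  have h1 : algebraMap ℂ A R ^ j * ((-2 : ℂ) • x) ^ (m - j) * (m.choose j : A) * b
      = (R ^ j * (-2) ^ (m - j) * (m.choose j : ℂ)) • (x ^ (m - j) * b) := by
    rw [smul_pow, ← map_natCast (algebraMap ℂ A) (m.choose j)]
    simp only [Algebra.smul_def, map_mul, map_pow]
    ring
  rw [h1, map_smul, h, smul_zero]

variable [CompleteSpace A]

/-- If a functional kills `w ^ i * b` for all `i`, then it kills `exp (s • w) * b`. -/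
theorem apply_exp_smul_mul_eq_zero (Λ : A →L[ℂ] ℂ) (w b : A) (h : ∀ i, Λ (w ^ i * b) = 0)
    (s : ℂ) : Λ (NormedSpace.exp (s • w) * b) = 0 := by
  have hs := ((NormedSpace.exp_series_hasSum_exp' (𝕂 := ℂ) (s • w)).mul_right b).mapL Λ
  refine hs.unique ?_
  convert hasSum_zero with n
  rw [smul_mul_assoc, smul_pow, smul_mul_assoc, map_smul, map_smul, h, smul_zero, smul_zero]

/-- If `s ↦ Λ (exp (s • w) * b)` vanishes on the unit circle, then `Λ` kills all `w ^ i * b`. -/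
theorem apply_pow_mul_eq_zero (Λ : A →L[ℂ] ℂ) (w b : A)
    (h : ∀ ζ : ℂ, ‖ζ‖ = 1 → Λ (NormedSpace.exp (ζ • w) * b) = 0) (i : ℕ) :
    Λ (w ^ i * b) = 0 := by
  have hd (c : A) (s : ℂ) : HasDerivAt (fun s : ℂ ↦ Λ (NormedSpace.exp (s • w) * c))
      (Λ (NormedSpace.exp (s • w) * (w * c))) s := by
    rw [← mul_assoc]
    exact Λ.hasFDerivAt.comp_hasDerivAt s ((hasDerivAt_exp_smul_const w s).mul_const c)
  have hball : ∀ s ∈ Metric.ball (0 : ℂ) 1, Λ (NormedSpace.exp (s • w) * b) = 0 := by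
    intro s hs
    have hdiff : Differentiable ℂ (fun s : ℂ ↦ Λ (NormedSpace.exp (s • w) * b)) :=
      fun s ↦ (hd b s).differentiableAt
    -- Maximum modulus principle with bound 0 on the circle.
    refine norm_le_zero_iff.1 (Complex.norm_le_of_forall_mem_frontier_norm_le
      (Metric.isBounded_ball (x := (0 : ℂ)) (r := 1)) hdiff.diffContOnCl (C := 0) ?_
      (subset_closure hs))
    intro ζ hζ
    rw [frontier_ball _ one_ne_zero, mem_sphere_zero_iff_norm] at hζ
    rw [h ζ hζ, norm_zero]
  have hall : ∀ i, ∀ s ∈ Metric.ball (0 : ℂ) 1,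
      Λ (NormedSpace.exp (s • w) * (w ^ i * b)) = 0 := by
    intro i
    induction i with
    | zero => simpa using hball
    | succ i ih =>
      intro s hs
      -- Each differentiation in $s$ brings down one factor `w`.
      have h0 : HasDerivAt (fun s : ℂ ↦ Λ (NormedSpace.exp (s • w) * (w ^ i * b))) 0 s :=
        (hasDerivAt_const s (0 : ℂ)).congr_of_eventuallyEq
          (Filter.eventuallyEq_of_mem (Metric.isOpen_ball.mem_nhds hs) ih)
      rw [pow_succ', mul_assoc]
      exact (hd _ s).unique h0
  simpa using hall i 0 (by simp)

/-- The moments `Λ (w ^ i * w' ^ j)` vanish as soon as those of `ζ • w + ζ⁻¹ • w'`, weighted by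
`exp ((ζ / 2) • w)`, vanish for all `ζ` on the unit circle. -/
theorem apply_pow_mul_pow_eq_zero (Λ : A →L[ℂ] ℂ) (w w' : A)
    (h : ∀ ζ : ℂ, ‖ζ‖ = 1 → ∀ m : ℕ,
      Λ ((ζ • w + ζ⁻¹ • w') ^ m * NormedSpace.exp ((ζ / 2) • w)) = 0) (i j : ℕ) :
    Λ (w ^ i * w' ^ j) = 0 := by
  induction j using Nat.strong_induction_on generalizing i with
  | _ j ih =>
    have key : ∀ ζ : ℂ, ‖ζ‖ = 1 →
        Λ (NormedSpace.exp (ζ • ((2 : ℂ)⁻¹ • w)) * w' ^ j) = 0 := by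
      intro ζ hζ
      have hζ0 : ζ ≠ 0 := by rintro rfl; simp at hζ
      have h1 := h ζ hζ j
      -- After `add_comm` the summation index is the exponent of `w'`, so the one term not covered
      -- by `ih` comes last.
      rw [add_comm, add_pow, Finset.sum_mul, map_sum, Finset.sum_range_succ,
        Finset.sum_eq_zero, zero_add] at h1
      · have h2 : (ζ⁻¹ • w') ^ j * (ζ • w) ^ (j - j) * (j.choose j : A) *
            NormedSpace.exp ((ζ / 2) • w)
            = (ζ⁻¹) ^ j • (NormedSpace.exp (ζ • ((2 : ℂ)⁻¹ • w)) * w' ^ j) := by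
          rw [smul_smul, ← div_eq_mul_inv, smul_pow, Nat.sub_self, Nat.choose_self]
          simp [mul_comm]
        rw [h2, map_smul, smul_eq_zero] at h1
        exact h1.resolve_left (pow_ne_zero _ (inv_ne_zero hζ0))
      · intro k hk
        have hk' := Finset.mem_range.1 hk
        have h2 : (ζ⁻¹ • w') ^ k * (ζ • w) ^ (j - k) * (j.choose k : A) *
            NormedSpace.exp ((ζ / 2) • w)
            = ((ζ⁻¹) ^ k * ζ ^ (j - k) * (j.choose k : ℂ)) •
              (NormedSpace.exp ((ζ / 2) • w) * (w ^ (j - k) * w' ^ k)) := by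
          rw [smul_pow, smul_pow, ← map_natCast (algebraMap ℂ A) (j.choose k)]
          simp only [Algebra.smul_def, map_mul]
          ring
        rw [h2, map_smul, apply_exp_smul_mul_eq_zero Λ w, smul_zero]
        intro a
        rw [← mul_assoc, ← pow_add]
        exact ih k hk' _
    have h3 := apply_pow_mul_eq_zero Λ ((2 : ℂ)⁻¹ • w) (w' ^ j) key i
    rw [smul_pow, smul_mul_assoc, map_smul, smul_eq_zero] at h3
    exact h3.resolve_left (pow_ne_zero _ (by norm_num))

/-- With `w'` the conjugate of `w` and $s=i/2$, the exponential is the character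
$e^{i\operatorname{Re}w}$. -/
theorem apply_exp_smul_add_eq_zero (Λ : A →L[ℂ] ℂ) (w w' : A)
    (h : ∀ i j : ℕ, Λ (w ^ i * w' ^ j) = 0) (s : ℂ) :
    Λ (NormedSpace.exp (s • (w + w'))) = 0 := by
  rw [← mul_one (NormedSpace.exp _)]
  refine apply_exp_smul_mul_eq_zero Λ _ _ (fun i ↦ ?_) s
  rw [mul_one, add_pow, map_sum]
  refine Finset.sum_eq_zero fun k _ ↦ ?_
  rw [mul_comm, ← nsmul_eq_mul, map_nsmul, h, smul_zero]

end BanachAlgebra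

/-! ### Complex measures through their real and imaginary parts. -/

section ComplexMeasure

variable {X : Type*} [MeasurableSpace X]

theorem ComplexMeasure.variation_le (μ : ComplexMeasure X) :
    μ.variation ≤ (ComplexMeasure.re μ).variation + (ComplexMeasure.im μ).variation := by
  refine VectorMeasure.variation_le_of_forall_enorm_le fun E _ ↦ ?_
  rw [Measure.add_apply]
  refine le_trans ?_ (add_le_add ((ComplexMeasure.re μ).enorm_measure_le_variation E)
    ((ComplexMeasure.im μ).enorm_measure_le_variation E))
  have h : μ E = (((ComplexMeasure.re μ) E : ℝ) : ℂ) +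
      (((ComplexMeasure.im μ) E : ℝ) : ℂ) * Complex.I := (Complex.re_add_im (μ E)).symm
  rw [h]
  refine (enorm_add_le _ _).trans_eq ?_
  simp [← ofReal_norm]

theorem ComplexMeasure.isFiniteMeasure_variation (μ : ComplexMeasure X) :
    IsFiniteMeasure μ.variation := by
  have h := ComplexMeasure.variation_le μ
  simp only [← SignedMeasure.totalVariation_eq_variation] at h
  exact isFiniteMeasure_of_le _ h

theorem ComplexMeasure.integral_mul_left (μ : ComplexMeasure X) (c : ℂ) {f : X → ℂ} (hf : μ.Integrable f) :
    VectorMeasure.integral μ (fun x ↦ c * f x) (ContinuousLinearMap.mul ℝ ℂ) =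
      c * VectorMeasure.integral μ f (ContinuousLinearMap.mul ℝ ℂ) := by
  have h1 := VectorMeasure.integral_continuousLinearMap_comp (μ := μ)
    (B := ContinuousLinearMap.mul ℝ ℂ) (C := ContinuousLinearMap.mul ℝ ℂ c) hf
  have h2 := VectorMeasure.continuousLinearMap_apply_integral (μ := μ)
    (B := ContinuousLinearMap.mul ℝ ℂ) (C := ContinuousLinearMap.mul ℝ ℂ c) hf
  simp only [ContinuousLinearMap.mul_apply'] at h1 h2
  rw [h1, h2]
  congr 1
  ext x y
  exact mul_assoc c x y

/-- The integral of a complex function with respect to a signed measure, through its Jordan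
decomposition. -/
theorem SignedMeasure.integral_eq_sub (s : SignedMeasure X) {f : X → ℂ}
    (hf : Integrable f s.totalVariation) :
    VectorMeasure.integral s f (ContinuousLinearMap.lsmul ℝ ℝ).flip =
      ∫ x, f x ∂s.toJordanDecomposition.posPart - ∫ x, f x ∂s.toJordanDecomposition.negPart := by
  have hp := (integrable_add_measure.1 hf).1
  have hn := (integrable_add_measure.1 hf).2
  conv_lhs => rw [← s.toSignedMeasure_toJordanDecomposition]
  rw [JordanDecomposition.toSignedMeasure, VectorMeasure.integral_sub_vectorMeasure,
    VectorMeasure.integral_toSignedMeasure, VectorMeasure.integral_toSignedMeasure]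
  · rwa [VectorMeasure.Integrable, Measure.variation_toSignedMeasure]
  · rwa [VectorMeasure.Integrable, Measure.variation_toSignedMeasure]

theorem ComplexMeasure.integral_eq_re_add_im (μ : ComplexMeasure X) {f : X → ℂ}
    (hre : Integrable f (ComplexMeasure.re μ).totalVariation)
    (him : Integrable f (ComplexMeasure.im μ).totalVariation) :
    VectorMeasure.integral μ f (ContinuousLinearMap.mul ℝ ℂ) =
      VectorMeasure.integral (ComplexMeasure.re μ) f (ContinuousLinearMap.lsmul ℝ ℝ).flip +
      Complex.I *
        VectorMeasure.integral (ComplexMeasure.im μ) f (ContinuousLinearMap.lsmul ℝ ℝ).flip := by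
  rw [SignedMeasure.totalVariation_eq_variation] at hre him
  have h2 := VectorMeasure.continuousLinearMap_apply_integral (μ := ComplexMeasure.im μ)
    (B := (ContinuousLinearMap.lsmul ℝ ℝ).flip)
    (C := ContinuousLinearMap.mul ℝ ℂ Complex.I) him
  rw [ContinuousLinearMap.mul_apply'] at h2
  rw [h2]
  -- The integral is additive in its set function; `ComplexMeasure.variation_le` supplies the
  -- domination.
  refine setToFun_add_left'' ?_ hre him ?_ (by positivity) (by positivity) (by positivity)
  · intro s _ _
    refine ContinuousLinearMap.ext fun x ↦ ?_
    change x * μ s = (μ s).re • x + Complex.I * ((μ s).im • x)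
    rw [Complex.real_smul, Complex.real_smul]
    linear_combination -x * Complex.re_add_im (μ s)
  · exact ComplexMeasure.variation_le μ

end ComplexMeasure

/-! ### Injectivity of the Fourier transform. -/

section CharFun

variable {E : Type*} [NormedAddCommGroup E] [InnerProductSpace ℝ E] [MeasurableSpace E]
  [BorelSpace E] [CompleteSpace E] [SecondCountableTopology E]

/-- A complex measure whose Fourier transform vanishes is zero. -/
theorem ComplexMeasure.eq_zero_of_fourier_eq_zero (μ : ComplexMeasure E)
    (h : ∀ t : E, VectorMeasure.integral μ (fun x ↦ Complex.exp (inner ℝ x t * Complex.I))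
      (ContinuousLinearMap.mul ℝ ℂ) = 0) : μ = 0 := by
  have hint (ν : Measure E) [IsFiniteMeasure ν] (t : E) :
      Integrable (fun x ↦ Complex.exp (inner ℝ x t * Complex.I)) ν :=
    Integrable.of_bound (C := 1) (by fun_prop) (by simp [Complex.norm_exp_ofReal_mul_I])
  set a := (ComplexMeasure.re μ).toJordanDecomposition.posPart
  set b := (ComplexMeasure.re μ).toJordanDecomposition.negPart
  set c := (ComplexMeasure.im μ).toJordanDecomposition.posPart
  set d := (ComplexMeasure.im μ).toJordanDecomposition.negPart
  have h1 (t : E) : (charFun a t - charFun b t) + Complex.I * (charFun c t - charFun d t) = 0 := by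
    rw [← h t, ComplexMeasure.integral_eq_re_add_im μ (hint _ t) (hint _ t),
      SignedMeasure.integral_eq_sub _ (hint _ t), SignedMeasure.integral_eq_sub _ (hint _ t)]
    rfl
  -- Conjugating `h1` at $-t$ flips only the sign of $i$, which separates the real and imaginary
  -- parts of $\mu$.
  have h2 (t : E) : (charFun a t - charFun b t) - Complex.I * (charFun c t - charFun d t) = 0 := by
    have := congrArg conj (h1 (-t))
    simpa [charFun_neg, ← sub_eq_add_neg] using this
  have hab : a = b := Measure.ext_of_charFun (funext fun t ↦ by
    linear_combination (h1 t + h2 t) / 2)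
  have hcd : c = d := Measure.ext_of_charFun (funext fun t ↦ by
    refine mul_left_cancel₀ Complex.I_ne_zero ?_
    linear_combination (h1 t - h2 t) / 2)
  have hzero (s : SignedMeasure E)
      (hs : s.toJordanDecomposition.posPart = s.toJordanDecomposition.negPart) : s = 0 := by
    rw [← s.toSignedMeasure_toJordanDecomposition, JordanDecomposition.toSignedMeasure]
    simp [hs]
  have hre := hzero _ hab
  have him := hzero _ hcd
  rw [← ComplexMeasure.toComplexMeasure_to_signedMeasure μ, hre, him]
  ext s hs
  simp [SignedMeasure.toComplexMeasure_apply]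
  rfl

end CharFun

/-! ### Integration over a compact set as a functional. -/

/-- Integration against a complex measure carried by a compact set `K`, as a continuous linear
functional on `C(K, ℂ)`. -/
theorem ComplexMeasure.exists_continuousLinearMap {X : Type*} [TopologicalSpace X]
    [MeasurableSpace X] [BorelSpace X] (μ : ComplexMeasure X) (K : Set X) [CompactSpace K]
    (hK : MeasurableSet K) (hμ : μ.variation Kᶜ = 0) :
    ∃ Λ : C(K, ℂ) →L[ℂ] ℂ, ∀ (f : X → ℂ) (g : C(K, ℂ)), (∀ x : K, f x = g x) →
      VectorMeasure.integral μ f (ContinuousLinearMap.mul ℝ ℂ) = Λ g := by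
  have := ComplexMeasure.isFiniteMeasure_variation μ
  -- Extension by zero; the values off `K` are irrelevant because the variation vanishes there.
  let ext (g : C(K, ℂ)) : X → ℂ := Function.extend Subtype.val g 0
  have hext (g : C(K, ℂ)) (x : K) : ext g x = g x := Subtype.val_injective.extend_apply _ _ _
  have hae : ∀ᵐ x ∂μ.variation, x ∈ K := hμ
  have hbound (g : C(K, ℂ)) : ∀ᵐ x ∂μ.variation, ‖ext g x‖ ≤ ‖g‖ := by
    filter_upwards [hae] with x hx
    rw [hext g ⟨x, hx⟩]
    exact g.norm_coe_le_norm _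
  have hint (g : C(K, ℂ)) : μ.Integrable (ext g) :=
    Integrable.of_bound ((MeasurableEmbedding.subtype_coe hK).measurable_extend
      g.continuous.measurable measurable_zero).aestronglyMeasurable ‖g‖ (hbound g)
  let Λ₀ : C(K, ℂ) →ₗ[ℂ] ℂ :=
    { toFun g := VectorMeasure.integral μ (ext g) (ContinuousLinearMap.mul ℝ ℂ)
      map_add' g g' := by
        rw [← VectorMeasure.integral_add (hint g) (hint g')]
        refine VectorMeasure.integral_congr_ae ?_
        filter_upwards [hae] with x hx
        exact (hext (g + g') ⟨x, hx⟩).trans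
          (congrArg₂ (· + ·) (hext g ⟨x, hx⟩) (hext g' ⟨x, hx⟩)).symm
      map_smul' c g := by
        rw [RingHom.id_apply, smul_eq_mul, ← ComplexMeasure.integral_mul_left μ c (hint g)]
        refine VectorMeasure.integral_congr_ae ?_
        filter_upwards [hae] with x hx
        exact (hext (c • g) ⟨x, hx⟩).trans (congrArg (c * ·) (hext g ⟨x, hx⟩)).symm }
  refine ⟨Λ₀.mkContinuous (‖ContinuousLinearMap.mul ℝ ℂ‖ * μ.variation.real Set.univ)
    fun g ↦ ?_, fun f g hfg ↦ ?_⟩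
  · refine (VectorMeasure.norm_integral_le_of_norm_le_const (hbound g)).trans_eq ?_
    ring
  · rw [LinearMap.mkContinuous_apply]
    refine VectorMeasure.integral_congr_ae ?_
    filter_upwards [hae] with x hx
    exact (hfg ⟨x, hx⟩).trans (hext g ⟨x, hx⟩).symm

theorem ContinuousMap.exp_apply {K : Type*} [TopologicalSpace K] [CompactSpace K] (f : C(K, ℂ))
    (x : K) : NormedSpace.exp f x = Complex.exp (f x) := by
  rw [Complex.exp_eq_exp_ℂ]
  exact NormedSpace.map_exp (ContinuousMap.evalAlgHom ℂ ℂ x) (continuous_eval_const x) f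

/-! ### The integrand on the sphere, and the theorem. -/

/-- The function `ω ↦ z · ω̄` on a subset of `ℂⁿ`. -/
noncomputable def innerRight {n : ℕ} (K : Set (EuclideanSpace ℂ (Fin n))) (z : EuclideanSpace ℂ (Fin n)) :
    C(K, ℂ) :=
  ⟨fun ω ↦ inner ℂ (ω : EuclideanSpace ℂ (Fin n)) z, by fun_prop⟩

theorem innerRight_apply {n : ℕ} (K : Set (EuclideanSpace ℂ (Fin n)))
    (z : EuclideanSpace ℂ (Fin n)) (ω : K) :
    innerRight K z ω = inner ℂ (ω : EuclideanSpace ℂ (Fin n)) z := rfl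

theorem innerRight_smul {n : ℕ} (K : Set (EuclideanSpace ℂ (Fin n))) (c : ℂ)
    (z : EuclideanSpace ℂ (Fin n)) : innerRight K (c • z) = c • innerRight K z := by
  ext ω
  simp [innerRight_apply]

/-- The integrand of a spectral projection is a Laguerre polynomial in `|z - ω|² / 2`, times an
exponential which for fixed `|ω|` and `|z|` depends on `z · ω̄` only. -/
theorem laguerreFun_mul_exp_eq (n k : ℕ) (z ω : EuclideanSpace ℂ (Fin n)) :
    (laguerreFun n k (z - ω) : ℂ) *
      Complex.exp (Complex.I / 2 * ((∑ j, z j * conj (ω j)).im : ℂ)) =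
    (∑ j ∈ Finset.range (k + 1),
      (((n - 1 + k).choose (k - j) : ℂ) * (-1) ^ j / (j.factorial : ℂ)) *
        ((((‖ω‖ ^ 2 + ‖z‖ ^ 2 : ℝ) : ℂ) - (inner ℂ ω z + conj (inner ℂ ω z))) / 2) ^ j) *
      (Complex.exp (-((‖ω‖ ^ 2 + ‖z‖ ^ 2 : ℝ) : ℂ) / 4) * Complex.exp (inner ℂ ω z / 2)) := by
  have hsum : ∑ j, z j * conj (ω j) = inner ℂ ω z := by
    simp [PiLp.inner_apply]
  have hnorm : ((‖z - ω‖ ^ 2 : ℝ) : ℂ) =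
      ((‖ω‖ ^ 2 + ‖z‖ ^ 2 : ℝ) : ℂ) - (inner ℂ ω z + conj (inner ℂ ω z)) := by
    rw [norm_sub_sq (𝕜 := ℂ) z ω, inner_re_symm, Complex.add_conj, ← Complex.ofReal_sub]
    congr 1
    simp only [RCLike.re_to_complex]
    ring
  rw [hsum, ← hnorm, laguerreFun, laguerrePoly, Complex.ofReal_mul, mul_assoc]
  congr 1
  · push_cast
    refine Finset.sum_congr rfl fun j _ ↦ ?_
    rw [neg_pow]
    ring
  · rw [Complex.ofReal_exp, ← Complex.exp_add, ← Complex.exp_add]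
    congr 1
    have h4 : ((-(‖z - ω‖ ^ 2 / 4) : ℝ) : ℂ) = -((‖z - ω‖ ^ 2 : ℝ) : ℂ) / 4 := by
      push_cast; ring
    rw [h4, hnorm, Complex.add_conj]
    push_cast
    linear_combination (1 / 2 : ℂ) * Complex.re_add_im (inner ℂ ω z)

theorem real_inner_eq_re_complex_inner {n : ℕ} (x y : EuclideanSpace ℂ (Fin n)) :
    inner ℝ x y = (inner ℂ x y).re := by
  simp [PiLp.inner_apply, Complex.inner]

theorem theorem5p1 (n : ℕ) (hn : 1 ≤ n) (r₁ r₂ : ℝ) (hr₁ : 0 < r₁) (hr₂ : 0 < r₂)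
    (μ : ComplexMeasure (EuclideanSpace ℂ (Fin n))) (hμ : IsACSphereMeasure n r₁ μ)
    (hvanish : ∀ k : ℕ, ∀ z ∈ Metric.sphere (0 : EuclideanSpace ℂ (Fin n)) r₂,
      spectralProjection n k μ z = 0) :
    μ = 0 := by
  set K := Metric.sphere (0 : EuclideanSpace ℂ (Fin n)) r₁
  have hKm : MeasurableSet K := Metric.isClosed_sphere.measurableSet
  have hcarried : μ.variation Kᶜ = 0 :=
    (VectorMeasure.variation_apply_eq_zero hKm.compl).2 fun t ht htm ↦
      hμ.supported t htm (disjoint_compl_left.mono_left ht)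
  obtain ⟨Λ, hΛ⟩ := ComplexMeasure.exists_continuousLinearMap μ K hKm hcarried
  have hre : ∀ z ∈ Metric.sphere (0 : EuclideanSpace ℂ (Fin n)) r₂, ∀ m : ℕ,
      Λ ((innerRight K z + star (innerRight K z)) ^ m *
        NormedSpace.exp ((2⁻¹ : ℂ) • innerRight K z)) = 0 := by
    intro z hz m
    set R : ℂ := ((r₁ ^ 2 + r₂ ^ 2 : ℝ) : ℂ)
    set u := innerRight K z + star (innerRight K z)
    set x : C(K, ℂ) := (2⁻¹ : ℂ) • (algebraMap ℂ C(K, ℂ) R - u) with hx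
    -- The scalar $e^{-R/4}$ is constant on the sphere and is cancelled at the end.
    set b : C(K, ℂ) := Complex.exp (-R / 4) • NormedSpace.exp ((2⁻¹ : ℂ) • innerRight K z) with hb
    have hlag : ∀ k, Λ (x ^ k * b) = 0 := by
      refine apply_pow_mul_eq_zero_of_laguerre Λ x b (n - 1) fun k ↦ ?_
      rw [← hvanish k z hz, spectralProjection]
      refine (hΛ _ _ fun ω ↦ ?_).symm
      rw [laguerreFun_mul_exp_eq, mem_sphere_zero_iff_norm.1 ω.2, mem_sphere_zero_iff_norm.1 hz]
      simp only [hx, hb, u, ContinuousMap.mul_apply, ContinuousMap.sum_apply,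
        ContinuousMap.smul_apply, ContinuousMap.pow_apply, ContinuousMap.sub_apply,
        ContinuousMap.add_apply, ContinuousMap.star_apply, ContinuousMap.exp_apply,
        innerRight_apply, smul_eq_mul, div_eq_inv_mul,
        Complex.star_def]
      rfl
    have hub : Λ (u ^ m * b) = 0 := apply_pow_mul_eq_zero_of_affine Λ u b R hlag m
    rw [hb, mul_smul_comm, map_smul, smul_eq_zero] at hub
    exact hub.resolve_left (Complex.exp_ne_zero _)
  have hmom : ∀ z ∈ Metric.sphere (0 : EuclideanSpace ℂ (Fin n)) r₂, ∀ i j : ℕ,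
      Λ (innerRight K z ^ i * star (innerRight K z) ^ j) = 0 := by
    intro z hz
    refine apply_pow_mul_pow_eq_zero Λ _ _ fun ζ hζ m ↦ ?_
    -- The sphere is invariant under $z\mapsto\zeta z$, and $\bar\zeta=\zeta^{-1}$.
    have h := hre (ζ • z) (by simpa [norm_smul, hζ] using hz) m
    rwa [innerRight_smul, star_smul, smul_smul, Complex.star_def,
      ← Complex.inv_eq_conj hζ, ← div_eq_inv_mul] at h
  refine ComplexMeasure.eq_zero_of_fourier_eq_zero μ fun t ↦ ?_
  -- Every frequency is a complex multiple of a point of the sphere; at $t=0$ this needs $n\ge1$, so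
  -- that the sphere is nonempty.
  obtain ⟨z, hz, s, rfl⟩ : ∃ z ∈ Metric.sphere (0 : EuclideanSpace ℂ (Fin n)) r₂,
      ∃ s : ℂ, t = s • z := by
    rcases eq_or_ne t 0 with rfl | ht
    · have : Nonempty (Fin n) := ⟨⟨0, hn⟩⟩
      obtain ⟨z, hz⟩ := NormedSpace.sphere_nonempty (E := EuclideanSpace ℂ (Fin n))
        (x := 0) (r := r₂) |>.2 hr₂.le
      exact ⟨z, hz, 0, by simp⟩
    · have ht' : ‖t‖ ≠ 0 := norm_ne_zero_iff.2 ht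
      refine ⟨((r₂ / ‖t‖ : ℝ) : ℂ) • t, ?_, ((‖t‖ / r₂ : ℝ) : ℂ), ?_⟩
      · rw [mem_sphere_zero_iff_norm, norm_smul, Complex.norm_real, Real.norm_of_nonneg
          (by positivity), div_mul_cancel₀ _ ht']
      · rw [smul_smul, ← Complex.ofReal_mul, div_mul_div_cancel₀ hr₂.ne', div_self ht',
          Complex.ofReal_one, one_smul]
  have hmom' : ∀ i j : ℕ, Λ (innerRight K (s • z) ^ i * star (innerRight K (s • z)) ^ j) = 0 := by
    intro i j
    rw [innerRight_smul, star_smul, smul_pow, smul_pow, smul_mul_smul_comm, map_smul,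
      hmom z hz, smul_zero]
  rw [← apply_exp_smul_add_eq_zero Λ _ _ hmom' (Complex.I / 2)]
  refine hΛ _ _ fun ω ↦ ?_
  rw [ContinuousMap.exp_apply, ContinuousMap.smul_apply, ContinuousMap.add_apply,
    ContinuousMap.star_apply, Complex.star_def, Complex.add_conj, innerRight_apply,
    real_inner_eq_re_complex_inner]
  congr 1
  rw [smul_eq_mul]
  push_cast
  ring
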